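/- Let $d\ge 1$ and let $\mathcal F_1,\dots,\mathcal F_{2d}$ be finite families of convex sets in Euclidean space $\mathbb R^d$. Assume that for any choice $F_1\in\mathcal F_1,\dots,F_{2d}\in\mathcal F_{2d}$ the diameter of the intersection $\bigcap_{i=1}^{2d}F_i$ is at least $1$. Then for some $i\in\{1,\dots,2d\}$ the intersection of all sets in the family $\mathcal F_i$ has diameter at least $\frac{1}{2d^2(2d)^{2d}}$. Here the diameter of a set is the supremum, in $[0,\infty]$, of the Euclidean distances between its points (it is $0$ for the empty set and $\infty$ for an unbounded set), and the intersection of an empty family is $\mathbb R^d$. -/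

import Mathlib

/-! Suppose every family has intersection of diameter below `s`, with `s` less than the claimed
bound. A Helly-type theorem for the diameter (`exists_dist_ge_of_forall_exists_dist_ge`) picks `2d`
members of each family, repetition allowed, whose intersection has diameter below `2d²s`. This
leaves `N = (2d)^(2d)` rainbow choices, each intersection containing a segment of length at least
`2d²sN < 1`. Bang's lemma gives one vector `w`, `‖w‖ ≤ N`, along which all these segments are long
at once. Pairs `(x, y)` with `⟪w, y - x⟫` fixed form an affine space of dimension `2d - 1`, so
colorful Helly applies with `2d` colors: some color has two common points at distance at least
`2d²s`, a contradiction.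

The diameter theorem rests on a maximal-determinant choice of polar vectors: `d` sets carry these
vectors, `d` more bound their sum from below, and a homothety of ratio `-1/(d + d²)` then maps the
intersection of these `2d` sets into the intersection of all. -/

/-! ### Helly and colorful Helly. -/

/-- **Helly's theorem**, for a family with more members than the dimension plus one, any
all but one of which have a common point. -/
theorem exists_mem_of_forall_exists_mem_ne {V ι : Type*} [AddCommGroup V] [Module ℝ V]
    [FiniteDimensional ℝ V] [Fintype ι] (hcard : Module.finrank ℝ V + 1 < Fintype.card ι)
    {C : ι → Set V} (hC : ∀ i, Convex ℝ (C i)) (h : ∀ i, ∃ x, ∀ j, j ≠ i → x ∈ C j) :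
    ∃ x, ∀ i, x ∈ C i := by
  classical
  have key := Convex.helly_theorem' (𝕜 := ℝ) (F := C) (s := Finset.univ) (fun i _ => hC i) (by
    intro I _ hI
    have : ∃ i, i ∉ I := by
      by_contra! hcon
      have := Finset.eq_univ_iff_forall.2 hcon
      rw [this, Finset.card_univ] at hI
      omega
    obtain ⟨i, hi⟩ := this
    obtain ⟨x, hx⟩ := h i
    refine ⟨x, Set.mem_iInter₂.2 fun j hj => hx j ?_⟩
    rintro rfl
    exact hi hj)
  obtain ⟨x, hx⟩ := key
  exact ⟨x, fun i => Set.mem_iInter₂.1 hx i (Finset.mem_univ i)⟩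

theorem exists_isMinOn_norm {V : Type*} [NormedAddCommGroup V] {S : Set V} (hS : IsCompact S)
    (hne : S.Nonempty) : ∃ p ∈ S, ∀ x ∈ S, ‖p‖ ≤ ‖x‖ := by
  obtain ⟨p, hp, hmin⟩ := hS.exists_isMinOn hne continuous_norm.continuousOn
  exact ⟨p, hp, fun x hx => hmin hx⟩

theorem eq_of_forall_norm_le_of_convex {V : Type*} [NormedAddCommGroup V] [InnerProductSpace ℝ V]
    {S : Set V} (hS : Convex ℝ S) {p q : V} (hp : p ∈ S) (hq : q ∈ S)
    (hmin : ∀ x ∈ S, ‖p‖ ≤ ‖x‖) (hpq : ‖q‖ ≤ ‖p‖) : p = q := by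
  have hmid : (1 / 2 : ℝ) • p + (1 / 2 : ℝ) • q ∈ S :=
    hS hp hq (by norm_num) (by norm_num) (by norm_num)
  have h1 := hmin _ hmid
  rw [← smul_add, norm_smul, Real.norm_of_nonneg (by norm_num : (0 : ℝ) ≤ 1 / 2)] at h1
  have h2 := parallelogram_law_with_norm ℝ p q
  have h3 : ‖p - q‖ = 0 := by
    nlinarith [norm_nonneg p, norm_nonneg q, norm_nonneg (p - q), norm_nonneg (p + q)]
  exact sub_eq_zero.1 (norm_eq_zero.1 h3)

/-- The **colorful Helly theorem** for compact convex sets. -/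
theorem colorful_helly_of_isCompact {V κ α : Type*} [NormedAddCommGroup V] [InnerProductSpace ℝ V]
    [FiniteDimensional ℝ V] [Fintype κ] [Finite α] [Nonempty α]
    (hcard : Fintype.card κ = Module.finrank ℝ V + 1) {C : κ → α → Set V}
    (hC : ∀ k a, Convex ℝ (C k a)) (hcomp : ∀ k a, IsCompact (C k a))
    (h : ∀ ρ : κ → α, ∃ x, ∀ k, x ∈ C k (ρ k)) : ∃ k, ∃ x, ∀ a, x ∈ C k a := by
  classical
  -- With a single color, the sets `P` below would be empty intersections, hence not contained in
  -- any compact `C j a`.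
  by_cases hn : Fintype.card κ = 1
  · obtain ⟨k, hk⟩ := Fintype.card_eq_one_iff.1 hn
    have hz : Module.finrank ℝ V = 0 := by omega
    have := Module.finrank_zero_iff.1 hz
    refine ⟨k, 0, fun a => ?_⟩
    obtain ⟨x, hx⟩ := h fun _ => a
    rw [Subsingleton.elim 0 x]
    exact hx k
  have hpos : 1 < Fintype.card κ := by omega
  have hnt : Nontrivial κ := Fintype.one_lt_card_iff_nontrivial.1 hpos
  let P : κ × (κ → α) → Set V := fun t => ⋂ j : {j // j ≠ t.1}, C j (t.2 j)
  have memP : ∀ t x, x ∈ P t ↔ ∀ j, j ≠ t.1 → x ∈ C j (t.2 j) := by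
    intro t x
    simp [P, Set.mem_iInter]
  have hP : ∀ t, ∃ p ∈ P t, ∀ x ∈ P t, ‖p‖ ≤ ‖x‖ := by
    intro t
    obtain ⟨j, hj⟩ := exists_ne t.1
    refine exists_isMinOn_norm (IsCompact.of_isClosed_subset (hcomp j (t.2 j))
      (isClosed_iInter fun i => (hcomp _ _).isClosed) fun x hx => (memP t x).1 hx j hj) ?_
    obtain ⟨x, hx⟩ := h t.2
    exact ⟨x, (memP t x).2 fun j _ => hx j⟩
  choose p hpP hpmin using hP
  -- Extremal choice: the omitted color whose least-norm point is farthest from the origin. If that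
  -- point misses `C k a`, recoloring `k` by `a` pushes the least-norm point `q` strictly farther;
  -- Helly with the open ball of radius `‖q‖` then contradicts minimality of `q`.
  obtain ⟨⟨k, ρ⟩, hmax⟩ := Finite.exists_max fun t => ‖p t‖
  refine ⟨k, p (k, ρ), fun a => ?_⟩
  by_contra hpa
  let σ := Function.update ρ k a
  have hσ : ∀ j, j ≠ k → σ j = ρ j := fun j hj => Function.update_of_ne hj _ _
  have hσk : σ k = a := Function.update_self _ _ _
  have hQ : ∃ q ∈ ⋂ j, C j (σ j), ∀ x ∈ ⋂ j, C j (σ j), ‖q‖ ≤ ‖x‖ := by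
    refine exists_isMinOn_norm (IsCompact.of_isClosed_subset (hcomp k (σ k))
      (isClosed_iInter fun i => (hcomp _ _).isClosed) (Set.iInter_subset _ k)) ?_
    obtain ⟨x, hx⟩ := h σ
    exact ⟨x, Set.mem_iInter.2 hx⟩
  obtain ⟨q, hq, hqmin⟩ := hQ
  rw [Set.mem_iInter] at hq
  have hqP : q ∈ P (k, ρ) := (memP _ _).2 fun j hj => by simpa only [hσ j hj] using hq j
  have hlt : ‖p (k, ρ)‖ < ‖q‖ := by
    by_contra! hle
    have := eq_of_forall_norm_le_of_convex (convex_iInter fun _ => hC _ _) (hpP (k, ρ)) hqP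
      (hpmin _) hle
    apply hpa
    rw [this, ← hσk]
    exact hq k
  obtain ⟨x, hx⟩ := exists_mem_of_forall_exists_mem_ne (ι := Option κ)
    (C := fun o => o.elim (Metric.ball 0 ‖q‖) fun j => C j (σ j))
    (by rw [Fintype.card_option]; omega)
    (by
      rintro (_ | j)
      · exact convex_ball _ _
      · exact hC _ _)
    (by
      rintro (_ | i)
      · refine ⟨q, ?_⟩
        rintro (_ | j) hj
        · exact absurd rfl hj
        · exact hq j
      · refine ⟨p (i, σ), ?_⟩
        rintro (_ | j) hj
        · exact mem_ball_zero_iff.2 ((hmax _).trans_lt hlt)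
        · exact (memP _ _).1 (hpP (i, σ)) j fun hji => hj (congrArg some hji))
  exact (mem_ball_zero_iff.1 (hx none)).not_ge (hqmin x (Set.mem_iInter.2 fun j => hx (some j)))

/-- The **colorful Helly theorem**. -/
theorem colorful_helly {V κ α : Type*} [NormedAddCommGroup V] [InnerProductSpace ℝ V]
    [FiniteDimensional ℝ V] [Fintype κ] [Finite α] [Nonempty α]
    (hcard : Fintype.card κ = Module.finrank ℝ V + 1) {C : κ → α → Set V}
    (hC : ∀ k a, Convex ℝ (C k a))
    (h : ∀ ρ : κ → α, ∃ x, ∀ k, x ∈ C k (ρ k)) : ∃ k, ∃ x, ∀ a, x ∈ C k a := by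
  choose x hx using h
  -- Hulls of finitely many witnesses are compact and lie inside the original sets.
  obtain ⟨k, y, hy⟩ := colorful_helly_of_isCompact (α := α) hcard
    (C := fun k a => convexHull ℝ (x '' {ρ | ρ k = a})) (fun _ _ => convex_convexHull _ _)
    (fun _ _ => (Set.toFinite _).isCompact_convexHull ℝ)
    (fun ρ => ⟨x ρ, fun k => subset_convexHull _ _ ⟨ρ, rfl, rfl⟩⟩)
  refine ⟨k, y, fun a => convexHull_min ?_ (hC k a) (hy a)⟩
  rintro _ ⟨ρ, rfl, rfl⟩
  exact hx ρ k

/-! ### Bang's lemma. -/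

/-- **Bang's lemma** for unit vectors. -/
theorem exists_one_le_abs_inner {V ι : Type*} [NormedAddCommGroup V] [InnerProductSpace ℝ V]
    [Fintype ι] (u : ι → V) (hu : ∀ i, ‖u i‖ = 1) :
    ∃ w : V, ‖w‖ ≤ Fintype.card ι ∧ ∀ i, 1 ≤ |inner ℝ w (u i)| := by
  classical
  let ε : (ι → Bool) → ι → ℝ := fun s i => if s i then 1 else -1
  have hε : ∀ s i, |ε s i| = 1 := by
    intro s i
    simp only [ε]
    split_ifs <;> simp
  let W : (ι → Bool) → V := fun s => ∑ i, ε s i • u i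
  -- For signs maximizing the norm of the signed sum, flipping sign `i` cannot increase it: `-4 ε
  -- ⟪W, u i⟫ + 4 ≤ 0`.
  obtain ⟨s, hs⟩ := Finite.exists_max fun s => ‖W s‖
  refine ⟨W s, ?_, fun i => ?_⟩
  · calc ‖W s‖ ≤ ∑ i, ‖ε s i • u i‖ := norm_sum_le _ _
      _ = Fintype.card ι := by simp [norm_smul, hε, hu]
  · have hflip : W (Function.update s i (!s i)) = W s - (2 * ε s i) • u i := by
      rw [sub_eq_add_neg, ← sub_eq_iff_eq_add', ← Finset.sum_sub_distrib,
        Finset.sum_eq_single i]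
      · rw [← sub_smul, ← neg_smul]
        congr 1
        simp only [ε, Function.update_self]
        cases s i <;> norm_num
      · intro j _ hj
        simp [ε, Function.update_of_ne hj]
      · simp
    have h1 := hs (Function.update s i (!s i))
    simp only [hflip] at h1
    have h2 := norm_sub_sq_real (W s) ((2 * ε s i) • u i)
    have h4 : ε s i ^ 2 = 1 := by rw [← sq_abs, hε, one_pow]
    have h3 : ‖(2 * ε s i) • u i‖ ^ 2 = 4 := by
      rw [norm_smul, hu, mul_one, Real.norm_eq_abs, sq_abs, mul_pow, h4]
      norm_num
    rw [h3, inner_smul_right] at h2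
    have h5 : ‖W s - (2 * ε s i) • u i‖ ^ 2 ≤ ‖W s‖ ^ 2 :=
      pow_le_pow_left₀ (norm_nonneg _) h1 2
    have h6 : 1 ≤ ε s i * inner ℝ (W s) (u i) := by linarith
    calc (1 : ℝ) ≤ |ε s i * inner ℝ (W s) (u i)| := h6.trans (le_abs_self _)
      _ = |inner ℝ (W s) (u i)| := by rw [abs_mul, hε, one_mul]

/-! ### Helly-type theorem for the diameter. -/

/-- Take `f` of maximal determinant in `S`, and let `w` be its dual basis. By Cramer's rule `⟪w i,
a⟫` is the ratio of determinants after replacing `f i` by `a`, so maximality bounds it by 1. -/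
theorem exists_dual_family_of_isCompact {E n : Type*} [NormedAddCommGroup E]
    [InnerProductSpace ℝ E] [FiniteDimensional ℝ E] [Fintype n]
    (b : OrthonormalBasis n ℝ E) {S : Set E} (hS : IsCompact S) {η : ℝ} (hη : 0 < η)
    (hball : Metric.closedBall 0 η ⊆ S) :
    ∃ f w : n → E, (∀ i, f i ∈ S) ∧ (∀ i, ∀ a ∈ S, inner ℝ (w i) a ≤ 1) ∧
      ∀ x, x = ∑ i, inner ℝ (f i) x • w i := by
  classical
  have hcont : Continuous fun f : n → E => b.toBasis.det f := by
    simp only [Module.Basis.det_apply]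
    refine Continuous.matrix_det (continuous_matrix fun i j => ?_)
    simp only [Module.Basis.toMatrix_apply, OrthonormalBasis.coe_toBasis_repr_apply,
      OrthonormalBasis.repr_apply_apply]
    fun_prop
  have hmem : (fun i => η • b i) ∈ Set.univ.pi fun _ : n => S := fun i _ =>
    hball (by simp [norm_smul, abs_of_pos hη])
  obtain ⟨f, hfS, hmax⟩ := (isCompact_univ_pi fun _ : n => hS).exists_isMaxOn ⟨_, hmem⟩
    hcont.continuousOn
  have hpos : 0 < b.toBasis.det f := by
    refine lt_of_lt_of_le ?_ (hmax hmem)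
    have h1 : b.toBasis.det (fun i => η • b i) = η ^ Fintype.card n := by
      have := b.toBasis.det.map_smul_univ (fun _ => η) b
      rw [this, ← b.coe_toBasis, Module.Basis.det_self]
      simp
    simp only [h1]
    positivity
  let L : n → E →ₗ[ℝ] ℝ := fun i =>
    (b.toBasis.det f)⁻¹ • b.toBasis.det.toMultilinearMap.toLinearMap f i
  have hL : ∀ i a, L i a = (b.toBasis.det f)⁻¹ * b.toBasis.det (Function.update f i a) :=
    fun i a => rfl
  let w : n → E := fun i => (InnerProductSpace.toDual ℝ E).symm (L i).toContinuousLinearMap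
  have hw : ∀ i a, inner ℝ (w i) a = L i a := fun i a => by simp [w]
  refine ⟨f, w, fun i => hfS i trivial, fun i a ha => ?_, fun x => ?_⟩
  · rw [hw, hL, inv_mul_le_iff₀ hpos, mul_one]
    refine hmax fun j _ => ?_
    rcases eq_or_ne j i with rfl | hj
    · simpa using ha
    · simpa [hj] using hfS j trivial
  · have hspan := ((Module.Basis.is_basis_iff_det b.toBasis).2 hpos.ne'.isUnit).2
    refine ext_inner_left ℝ fun v => ?_
    have hv : v ∈ Submodule.span ℝ (Set.range f) := hspan ▸ Submodule.mem_top
    induction hv using Submodule.span_induction with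
    | mem v hv =>
      obtain ⟨j, rfl⟩ := hv
      rw [inner_sum, Finset.sum_eq_single j]
      · rw [inner_smul_right, real_inner_comm (w j), hw, hL, Function.update_eq_self,
          inv_mul_cancel₀ hpos.ne', mul_one, real_inner_comm]
      · intro i _ hij
        rw [inner_smul_right, real_inner_comm (w i), hw, hL,
          b.toBasis.det.map_eq_zero_of_eq (i := i) (j := j)
            (Function.update f i (f j)) (by rw [Function.update_self, Function.update_of_ne (Ne.symm hij)]) hij]
        simp
      · simp
    | zero => simp
    | add v v' _ _ h h' => rw [inner_add_left, inner_add_left, h, h']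
    | smul c v _ h => rw [inner_smul_left, inner_smul_left, h]

/-- The point must lie in every copy of `K` shrunk by `d/(d+1)` towards a point `x` of `K`. Any `d +
1` such copies share the barycenter of their points `x`, so Helly applies. -/
theorem exists_minkowski_center {E : Type*} [NormedAddCommGroup E] [NormedSpace ℝ E]
    [FiniteDimensional ℝ E] {K : Set E} (hK : Convex ℝ K) (hcomp : IsCompact K)
    (hne : K.Nonempty) {d : ℕ} (hd : Module.finrank ℝ E = d) (hd0 : 0 < d) :
    ∃ p ∈ K, ∀ x ∈ K, p - (d : ℝ)⁻¹ • (x - p) ∈ K := by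
  classical
  have hd' : (0 : ℝ) < d := by exact_mod_cast hd0
  have hd1 : (d : ℝ) + 1 ≠ 0 := by positivity
  let T : E → E → E := fun x y => ((d : ℝ) / (d + 1)) • y + ((d : ℝ) + 1)⁻¹ • x
  have hT : ∀ x p, p - (d : ℝ)⁻¹ • (x - p) ∈ K ↔ p ∈ T x '' K := by
    intro x p
    constructor
    · intro h
      refine ⟨_, h, ?_⟩
      simp only [T]
      match_scalars <;> field_simp <;> ring
    · rintro ⟨y, hy, rfl⟩
      convert hy using 1
      simp only [T]
      match_scalars <;> field_simp <;> ring
  have hTconv : ∀ x : K, Convex ℝ (T x '' K) := fun x => by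
    have : T x = fun y => ((d : ℝ) + 1)⁻¹ • x.1 + ((d : ℝ) / (d + 1)) • y :=
      funext fun y => add_comm _ _
    rw [this]
    exact hK.affinity _ _
  have hTcomp : ∀ x : K, IsCompact (T x '' K) := fun x => hcomp.image (by fun_prop)
  obtain ⟨x₀, hx₀⟩ := hne
  obtain ⟨p, hp⟩ := Convex.helly_theorem_compact' (𝕜 := ℝ) hTconv hTcomp (by
    intro I hI
    rw [hd] at hI
    refine ⟨((d : ℝ) + 1)⁻¹ • (∑ i ∈ I, (i : E) + ((d : ℝ) + 1 - I.card) • x₀),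
      Set.mem_iInter₂.2 fun i hi => ?_⟩
    have hm : ((I.erase i).card : ℝ) + 1 = I.card := by
      exact_mod_cast Finset.card_erase_add_one hi
    have hI' : (I.card : ℝ) ≤ d + 1 := by exact_mod_cast hI
    have hy := hK.sum_mem (t := Finset.insertNone (I.erase i))
      (w := fun o => o.elim (((d : ℝ) - (I.erase i).card) * (d : ℝ)⁻¹) fun _ => (d : ℝ)⁻¹)
      (z := fun o => o.elim x₀ fun x => (x : E))
      (by
        rintro (_ | j) _
        · exact mul_nonneg (by linarith) (by positivity)
        · exact (inv_pos.2 hd').le)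
      (by
        simp only [Finset.sum_insertNone, Option.elim, Finset.sum_const, nsmul_eq_mul]
        field_simp
        ring)
      (by
        rintro (_ | j) _
        · exact hx₀
        · exact j.2)
    simp only [Finset.sum_insertNone, Option.elim, ← Finset.smul_sum] at hy
    refine ⟨_, hy, ?_⟩
    simp only [T]
    rw [← Finset.add_sum_erase I (fun i => (i : E)) hi, ← hm]
    match_scalars <;> field_simp
    ring)
  rw [Set.mem_iInter] at hp
  have hp' : ∀ x ∈ K, p - (d : ℝ)⁻¹ • (x - p) ∈ K := fun x hx => (hT x p).2 (hp ⟨x, hx⟩)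
  refine ⟨p, ?_, hp'⟩
  obtain ⟨y, hy, rfl⟩ := hp ⟨x₀, hx₀⟩
  refine hK hy hx₀ (by positivity) (by positivity) (by field_simp)

theorem Finset.exists_fin_forall_mem_exists {ι : Type*} [Nonempty ι] (s : Finset ι) {n : ℕ}
    (hs : s.card ≤ n) : ∃ J : Fin n → ι, ∀ i ∈ s, ∃ k, J k = i := by
  refine ⟨fun k => if h : (k : ℕ) < s.card then s.equivFin.symm ⟨k, h⟩ else Classical.arbitrary ι,
    fun i hi => ⟨⟨s.equivFin ⟨i, hi⟩, (s.equivFin ⟨i, hi⟩).2.trans_le hs⟩, ?_⟩⟩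
  simp

/-- One of the `d + 1` sets in Helly's theorem can be taken to be `G`, because `p` already serves
every subfamily without `G`. -/
theorem exists_fin_finrank_forall_not {E ι : Type*} [AddCommGroup E] [Module ℝ E]
    [FiniteDimensional ℝ E] [Nonempty ι] [Finite ι] {d : ℕ} (hd : Module.finrank ℝ E = d)
    {K : ι → Set E} {G : Set E} (hK : ∀ i, Convex ℝ (K i)) (hG : Convex ℝ G) {p : E}
    (hp : ∀ i, p ∈ K i) (hdisj : ∀ x, (∀ i, x ∈ K i) → x ∉ G) :
    ∃ J : Fin d → ι, ∀ x, (∀ k, x ∈ K (J k)) → x ∉ G := by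
  classical
  have := Fintype.ofFinite ι
  by_contra! hcon
  obtain ⟨x, hx⟩ := Convex.helly_theorem' (𝕜 := ℝ) (F := fun o : Option ι => o.elim G K)
    (s := Finset.univ)
    (by
      rintro (_ | i) _
      exacts [hG, hK i])
    (by
      intro I _ hI
      by_cases hn : none ∈ I
      · have hc : I.eraseNone.card ≤ d := by
          have h1 := Finset.card_eraseNone_eq_card_erase I
          rw [Finset.card_erase_of_mem hn] at h1
          omega
        obtain ⟨J, hJ⟩ := I.eraseNone.exists_fin_forall_mem_exists hc
        obtain ⟨x, hx, hxG⟩ := hcon J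
        refine ⟨x, Set.mem_iInter₂.2 ?_⟩
        rintro (_ | i) hi
        · exact hxG
        · obtain ⟨k, rfl⟩ := hJ i (Finset.mem_eraseNone.2 hi)
          exact hx k
      · refine ⟨p, Set.mem_iInter₂.2 ?_⟩
        rintro (_ | i) hi
        exacts [absurd hi hn, hp i])
  simp only [Finset.mem_univ, Set.iInter_true, Set.mem_iInter, Option.forall] at hx
  exact hdisj x hx.2 hx.1

theorem isCompact_setOf_forall_inner_le_one {E : Type*} [NormedAddCommGroup E]
    [InnerProductSpace ℝ E] [FiniteDimensional ℝ E] {K : Set E} {p : E} {r : ℝ} (hr : 0 < r)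
    (hball : Metric.closedBall p r ⊆ K) :
    IsCompact {a : E | ∀ x ∈ K, inner ℝ a (x - p) ≤ 1} := by
  refine IsCompact.of_isClosed_subset (isCompact_closedBall 0 r⁻¹) ?_ fun a ha => ?_
  · simp only [Set.ofPred_forall]
    exact isClosed_biInter fun x _ => isClosed_le (by fun_prop) continuous_const
  · rw [mem_closedBall_zero_iff]
    rcases eq_or_ne a 0 with rfl | ha0
    · simpa using hr.le
    have hn : 0 < ‖a‖ := norm_pos_iff.2 ha0
    have h := ha (p + (r / ‖a‖) • a) (hball (by
      rw [mem_closedBall_iff_norm, add_sub_cancel_left, norm_smul, Real.norm_of_nonneg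
        (by positivity), div_mul_cancel₀ _ hn.ne']))
    rw [add_sub_cancel_left, inner_smul_right, real_inner_self_eq_norm_sq] at h
    rw [le_inv_comm₀ hn hr, inv_eq_one_div, le_div_iff₀ hn]
    calc r * ‖a‖ = r / ‖a‖ * ‖a‖ ^ 2 := by field_simp
      _ ≤ 1 := h

theorem exists_closedBall_subset_setOf_forall_inner_le_one {E : Type*} [NormedAddCommGroup E]
    [InnerProductSpace ℝ E] {K : Set E} (hK : Bornology.IsBounded K) (p : E) :
    ∃ η > 0, Metric.closedBall 0 η ⊆ {a : E | ∀ x ∈ K, inner ℝ a (x - p) ≤ 1} := by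
  obtain ⟨R, hR, hKR⟩ := hK.subset_closedBall_lt 0 p
  refine ⟨R⁻¹, inv_pos.2 hR, fun a ha x hx => ?_⟩
  have h1 := mem_closedBall_iff_norm.1 (hKR hx)
  calc inner ℝ a (x - p) ≤ ‖a‖ * ‖x - p‖ := real_inner_le_norm _ _
    _ ≤ R⁻¹ * R := mul_le_mul (mem_closedBall_zero_iff.1 ha) h1 (norm_nonneg _) (by positivity)
    _ = 1 := inv_mul_cancel₀ hR.ne'

/-- One half of the bipolar theorem. -/
theorem add_mem_of_forall_inner_le_one {E : Type*} [NormedAddCommGroup E]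
    [InnerProductSpace ℝ E] [CompleteSpace E] {K : Set E} (hK : Convex ℝ K) (hc : IsClosed K)
    {p w : E} (hp : p ∈ K)
    (h : ∀ a, (∀ x ∈ K, inner ℝ a (x - p) ≤ 1) → inner ℝ w a ≤ 1) : p + w ∈ K := by
  by_contra hw
  obtain ⟨g, u, hgu, hug⟩ := geometric_hahn_banach_closed_point hK hc hw
  have hs : 0 < u - g p := sub_pos.2 (hgu p hp)
  let a := (u - g p)⁻¹ • (InnerProductSpace.toDual ℝ E).symm g
  have ha : ∀ x, inner ℝ a x = (u - g p)⁻¹ * g x := fun x => by simp [a, inner_smul_left]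
  have h1 := h a fun x hx => by
    rw [ha, inv_mul_le_iff₀ hs, map_sub]
    linarith [hgu x hx]
  rw [real_inner_comm, ha, inv_mul_le_iff₀ hs] at h1
  rw [map_add] at hug
  linarith

theorem closedBall_subset_of_minkowski_center {E : Type*} [NormedAddCommGroup E]
    [NormedSpace ℝ E] {K : Set E} (hK : Convex ℝ K) {d : ℕ} (hd0 : 0 < d) {p p₀ : E} {η : ℝ}
    (hball : Metric.closedBall p₀ η ⊆ K) (hp : p - (d : ℝ)⁻¹ • (p₀ - p) ∈ K) :
    Metric.closedBall p (η / (d + 1)) ⊆ K := by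
  have hd' : (0 : ℝ) < d := by exact_mod_cast hd0
  have hd1 : (0 : ℝ) < d + 1 := by positivity
  intro x hx
  -- `x` is the convex combination of this point and the reflected point in `hp`, with weights
  -- `1/(d+1)` and `d/(d+1)`.
  have h1 : p₀ + ((d : ℝ) + 1) • (x - p) ∈ K := hball (by
    rw [mem_closedBall_iff_norm] at hx ⊢
    rw [add_sub_cancel_left, norm_smul, Real.norm_of_nonneg hd1.le]
    rwa [le_div_iff₀' hd1] at hx)
  have h2 := hK h1 hp (a := ((d : ℝ) + 1)⁻¹) (b := d / (d + 1)) (by positivity) (by positivity)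
    (by field_simp; ring)
  convert h2 using 1
  match_scalars <;> field_simp <;> ring

/-- Among finitely many compact convex sets with a common interior point in dimension `d`,
some `2 * d` have an intersection of diameter at most `2 * d ^ 2` times that of the
intersection of all. -/
theorem exists_subfamily_dist_le_of_closedBall_subset {E ι : Type*} [NormedAddCommGroup E]
    [InnerProductSpace ℝ E] [FiniteDimensional ℝ E] [Finite ι] [Nonempty ι] {d : ℕ}
    (hd : Module.finrank ℝ E = d) (hd0 : 0 < d) {K : ι → Set E} (hK : ∀ i, Convex ℝ (K i))
    (hcomp : ∀ i, IsCompact (K i)) {p₀ : E} {η : ℝ} (hη : 0 < η)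
    (hball : ∀ i, Metric.closedBall p₀ η ⊆ K i) {D : ℝ}
    (hD : ∀ x y, (∀ i, x ∈ K i) → (∀ i, y ∈ K i) → dist x y ≤ D) :
    ∃ J : Fin (2 * d) → ι, ∀ x y, (∀ k, x ∈ K (J k)) → (∀ k, y ∈ K (J k)) →
      dist x y ≤ 2 * (d : ℝ) ^ 2 * D := by
  classical
  have hd' : (1 : ℝ) ≤ d := by exact_mod_cast hd0
  have hp₀ : ∀ i, p₀ ∈ K i := fun i => hball i (Metric.mem_closedBall_self hη.le)
  obtain ⟨p, hpK, hp⟩ := exists_minkowski_center (convex_iInter hK)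
    (IsCompact.of_isClosed_subset (hcomp (Classical.arbitrary ι))
      (isClosed_iInter fun i => (hcomp i).isClosed) (Set.iInter_subset _ _))
    ⟨p₀, Set.mem_iInter.2 hp₀⟩ hd hd0
  simp only [Set.mem_iInter] at hpK hp
  have hr : 0 < η / ((d : ℝ) + 1) := by positivity
  have hpball : ∀ i, Metric.closedBall p (η / (d + 1)) ⊆ K i := fun i =>
    closedBall_subset_of_minkowski_center (hK i) hd0 (hball i) (hp p₀ hp₀ i)
  obtain ⟨η', hη', hη'S⟩ := exists_closedBall_subset_setOf_forall_inner_le_one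
    (hcomp (Classical.arbitrary ι)).isBounded p
  obtain ⟨f, w, hfS, hwS, hfw⟩ := exists_dual_family_of_isCompact
    ((stdOrthonormalBasis ℝ E).reindex (finCongr hd))
    (isCompact_iUnion fun i => isCompact_setOf_forall_inner_le_one hr (hpball i)) hη'
    (hη'S.trans (Set.subset_iUnion_of_subset _ subset_rfl))
  simp only [Set.mem_iUnion, Set.mem_ofPred_eq] at hfS hwS
  choose j hj using hfS
  have hw : ∀ i l, p + w i ∈ K l := fun i l =>
    add_mem_of_forall_inner_le_one (hK l) (hcomp l).isClosed (hpK l) fun a ha => hwS i a ⟨l, ha⟩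
  -- The Minkowski center gives `-⟪f i, x - p⟫ ≤ d` on the full intersection, which therefore misses
  -- the half-space `G`.
  obtain ⟨J₂, hJ₂⟩ := exists_fin_finrank_forall_not hd hK
    (G := {x | (d : ℝ) ^ 2 < -∑ i, inner ℝ (f i) (x - p)}) (by
      have h := convex_halfSpace_lt (𝕜 := ℝ) (innerₛₗ ℝ (∑ i, f i)).isLinear
        (inner ℝ (∑ i, f i) p - (d : ℝ) ^ 2)
      refine (congrArg (Convex ℝ) (Set.ext fun x => ?_)).mpr h
      rw [Set.mem_ofPred_eq, Set.mem_ofPred_eq, ← sum_inner, inner_sub_right, innerₛₗ_apply_apply]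
      exact ⟨fun h => by linarith, fun h => by linarith⟩) hpK (by
      intro x hx
      simp only [Set.mem_ofPred_eq, not_lt, ← Finset.sum_neg_distrib]
      calc ∑ i, -inner ℝ (f i) (x - p) ≤ ∑ _i : Fin d, (d : ℝ) := Finset.sum_le_sum fun i _ => by
            have h1 := hj i _ (hp x hx (j i))
            rw [sub_sub_cancel_left, inner_neg_right, inner_smul_right, ← mul_neg,
              inv_mul_le_iff₀ (by linarith)] at h1
            linarith
        _ = (d : ℝ) ^ 2 := by simp [sq])
  simp only [Set.mem_ofPred_eq, not_lt] at hJ₂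
  obtain ⟨J, hJ⟩ := (Finset.univ.image j ∪ Finset.univ.image J₂).exists_fin_forall_mem_exists
    (n := 2 * d) (by
      refine (Finset.card_union_le _ _).trans ?_
      have h1 := Finset.card_image_le (s := Finset.univ) (f := j)
      have h2 := Finset.card_image_le (s := Finset.univ) (f := J₂)
      simp only [Finset.card_univ, Fintype.card_fin] at h1 h2
      omega)
  let M : ℝ := d + d ^ 2
  have hM : 0 < M := by positivity
  -- Since `x - p = ∑ ⟪f i, x - p⟫ w i`, `k x` is a convex combination of `p` and the points `p + w
  -- i`: the `f i` make the weights nonnegative, and `J₂` keeps their sum at most 1.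
  let k : E → E := fun x => p + M⁻¹ • (p + ∑ i, w i - x)
  have hk : ∀ x, (∀ k, x ∈ K (J k)) → ∀ l, k x ∈ K l := by
    intro x hx l
    have hx1 : ∀ i, inner ℝ (f i) (x - p) ≤ 1 := fun i => by
      obtain ⟨m, hm⟩ := hJ (j i) (by simp)
      exact hj i x (hm ▸ hx m)
    have hx2 := hJ₂ x fun i => by
      obtain ⟨m, hm⟩ := hJ (J₂ i) (by simp)
      exact hm ▸ hx m
    let u : Fin d → ℝ := fun i => M⁻¹ * (1 - inner ℝ (f i) (x - p))
    have hu0 : ∀ i, 0 ≤ u i := fun i => mul_nonneg (by positivity) (sub_nonneg.2 (hx1 i))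
    have hu1 : ∑ i, u i ≤ 1 := by
      simp only [u]
      rw [← Finset.mul_sum, inv_mul_le_iff₀ hM, Finset.sum_sub_distrib]
      simp only [Finset.sum_const, Finset.card_univ, Fintype.card_fin, nsmul_eq_mul, M]
      linarith
    have hmem := (hK l).sum_mem (t := (Finset.univ : Finset (Option (Fin d))))
      (w := fun o => o.elim (1 - ∑ i, u i) u) (z := fun o => o.elim p fun i => p + w i)
      (by
        rintro (_ | i) _
        exacts [sub_nonneg.2 hu1, hu0 i])
      (by simp [Fintype.sum_option])
      (by
        rintro (_ | i) _
        exacts [hpK l, hw i l])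
    convert hmem using 1
    simp only [Fintype.sum_option, Option.elim, smul_add, Finset.sum_add_distrib,
      ← Finset.sum_smul, k]
    have hsum : p + ∑ i, w i - x = ∑ i, (1 - inner ℝ (f i) (x - p)) • w i := by
      simp only [sub_smul, one_smul, Finset.sum_sub_distrib]
      rw [← hfw (x - p)]
      abel
    rw [hsum, Finset.smul_sum, sub_smul, one_smul]
    simp only [smul_smul, u]
    abel
  refine ⟨J, fun x y hx hy => ?_⟩
  have hD0 : 0 ≤ D := dist_nonneg.trans (hD p p hpK hpK)
  have h1 : dist (k x) (k y) ≤ D := hD _ _ (hk x hx) (hk y hy)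
  have h2 : dist (k x) (k y) = M⁻¹ * dist x y := by
    simp only [k, dist_eq_norm]
    rw [add_sub_add_left_eq_sub, ← smul_sub, sub_sub_sub_cancel_left, norm_smul,
      Real.norm_of_nonneg (by positivity), norm_sub_rev]
  rw [h2, inv_mul_le_iff₀ hM] at h1
  refine h1.trans (mul_le_mul_of_nonneg_right ?_ hD0)
  simp only [M]
  nlinarith

/-- If, among finitely many compact convex sets in dimension `d`, the intersection of any `2 * d`
has diameter at least `r`, then the intersection of all has diameter at least
`r / (2 * d ^ 2)`. -/
theorem exists_dist_ge_of_isCompact {E ι : Type*} [NormedAddCommGroup E]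
    [InnerProductSpace ℝ E] [FiniteDimensional ℝ E] [Finite ι] [Nonempty ι] {d : ℕ}
    (hd : Module.finrank ℝ E = d) (hd0 : 0 < d) {K : ι → Set E} (hK : ∀ i, Convex ℝ (K i))
    (hcomp : ∀ i, IsCompact (K i)) {r : ℝ}
    (h : ∀ J : Fin (2 * d) → ι, ∃ x y, (∀ k, x ∈ K (J k)) ∧ (∀ k, y ∈ K (J k)) ∧ r ≤ dist x y) :
    ∃ x y, (∀ i, x ∈ K i) ∧ (∀ i, y ∈ K i) ∧ r / (2 * (d : ℝ) ^ 2) ≤ dist x y := by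
  classical
  have := Fintype.ofFinite ι
  have hd' : (0 : ℝ) < d := by exact_mod_cast hd0
  obtain ⟨p, hp⟩ : ∃ p, ∀ i, p ∈ K i := by
    obtain ⟨p, hp⟩ := Convex.helly_theorem' (𝕜 := ℝ) (F := K) (s := Finset.univ)
      (fun i _ => hK i) (by
        intro I _ hI
        obtain ⟨J, hJ⟩ := I.exists_fin_forall_mem_exists (n := 2 * d) (by omega)
        obtain ⟨x, -, hx, -⟩ := h J
        refine ⟨x, Set.mem_iInter₂.2 fun i hi => ?_⟩
        obtain ⟨k, rfl⟩ := hJ i hi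
        exact hx k)
    exact ⟨p, fun i => Set.mem_iInter₂.1 hp i (Finset.mem_univ i)⟩
  -- Thickening by `δ n` supplies the common interior ball; compactness lets `δ n` tend to 0.
  let δ : ℕ → ℝ := fun n => 1 / ((n : ℝ) + 1)
  have hδ : ∀ n, 0 < δ n := fun n => Nat.one_div_pos_of_nat
  have hδanti : Antitone δ := fun m n hmn => Nat.one_div_le_one_div hmn
  let T : ℕ → ι → Set E := fun n i => Metric.cthickening (δ n) (K i)
  have hTcomp : ∀ n i, IsCompact (T n i) := fun n i => (hcomp i).cthickening
  have hKT : ∀ n i, K i ⊆ T n i := fun n i => Metric.self_subset_cthickening _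
  let P : ℕ → Set (E × E) := fun n =>
    ((⋂ i, T n i) ×ˢ (⋂ i, T n i)) ∩ {z | r / (2 * (d : ℝ) ^ 2) ≤ dist z.1 z.2}
  have hIcomp : ∀ n, IsCompact (⋂ i, T n i) := fun n =>
    IsCompact.of_isClosed_subset (hTcomp n (Classical.arbitrary ι))
      (isClosed_iInter fun i => (hTcomp n i).isClosed) (Set.iInter_subset _ _)
  have hPcomp : ∀ n, IsCompact (P n) := fun n =>
    ((hIcomp n).prod (hIcomp n)).inter_right
      (isClosed_le continuous_const (continuous_fst.dist continuous_snd))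
  have hPne : ∀ n, (P n).Nonempty := by
    intro n
    obtain ⟨⟨x, y⟩, ⟨hx, hy⟩, hmax⟩ := ((hIcomp n).prod (hIcomp n)).exists_isMaxOn
      (f := fun z : E × E => dist z.1 z.2)
      ⟨(p, p), Set.mem_iInter.2 fun i => hKT n i (hp i), Set.mem_iInter.2 fun i => hKT n i (hp i)⟩
      (continuous_fst.dist continuous_snd).continuousOn
    obtain ⟨J, hJ⟩ := exists_subfamily_dist_le_of_closedBall_subset hd hd0 (K := T n)
      (fun i => (hK i).cthickening _) (hTcomp n) (hδ n)
      (fun i => Metric.closedBall_subset_cthickening (hp i) _) (D := dist x y)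
      (fun x' y' hx' hy' => hmax (a := (x', y'))
        ⟨Set.mem_iInter.2 hx', Set.mem_iInter.2 hy'⟩)
    obtain ⟨x', y', hx', hy', hr⟩ := h J
    refine ⟨(x, y), ⟨hx, hy⟩, ?_⟩
    rw [Set.mem_ofPred_eq, div_le_iff₀' (by positivity)]
    exact hr.trans (hJ x' y' (fun k => hKT _ _ (hx' k)) fun k => hKT _ _ (hy' k))
  have hPanti : ∀ n, P (n + 1) ⊆ P n := fun n => by
    have hsub : (⋂ i, T (n + 1) i) ⊆ ⋂ i, T n i := Set.iInter_mono fun i =>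
      Metric.cthickening_mono (hδanti n.le_succ) _
    exact Set.inter_subset_inter_left _ (Set.prod_mono hsub hsub)
  obtain ⟨⟨x, y⟩, hxy⟩ := IsCompact.nonempty_iInter_of_sequence_nonempty_isCompact_isClosed P
    hPanti hPne (hPcomp 0) fun n => (hPcomp n).isClosed
  rw [Set.mem_iInter] at hxy
  have hlim : ∀ z i, (∀ n, z ∈ T n i) → z ∈ K i := by
    intro z i hz
    rw [← (hcomp i).isClosed.closure_eq, Metric.closure_eq_iInter_cthickening, Set.mem_iInter₂]
    intro ε hε
    obtain ⟨n, hn⟩ := exists_nat_one_div_lt hε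
    exact Metric.cthickening_mono hn.le _ (hz n)
  exact ⟨x, y, fun i => hlim x i fun n => Set.mem_iInter.1 (hxy n).1.1 i,
    fun i => hlim y i fun n => Set.mem_iInter.1 (hxy n).1.2 i, (hxy 0).2⟩

/-- A **Helly-type theorem for the diameter**: if, among finitely many convex sets in
dimension `d`, the intersection of any `2 * d` has diameter at least `r`, then the intersection
of all has diameter at least `r / (2 * d ^ 2)`. -/
theorem exists_dist_ge_of_forall_exists_dist_ge {E ι : Type*} [NormedAddCommGroup E]
    [InnerProductSpace ℝ E] [FiniteDimensional ℝ E] [Finite ι] [Nonempty ι] {d : ℕ}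
    (hd : Module.finrank ℝ E = d) (hd0 : 0 < d) {K : ι → Set E} (hK : ∀ i, Convex ℝ (K i)) {r : ℝ}
    (h : ∀ J : Fin (2 * d) → ι, ∃ x y, (∀ k, x ∈ K (J k)) ∧ (∀ k, y ∈ K (J k)) ∧ r ≤ dist x y) :
    ∃ x y, (∀ i, x ∈ K i) ∧ (∀ i, y ∈ K i) ∧ r / (2 * (d : ℝ) ^ 2) ≤ dist x y := by
  choose x y hx hy hr using h
  have hsub : ∀ i, convexHull ℝ (x '' {J | ∃ k, J k = i} ∪ y '' {J | ∃ k, J k = i}) ⊆ K i := by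
    refine fun i => convexHull_min (Set.union_subset ?_ ?_) (hK i)
    · rintro _ ⟨J, ⟨k, rfl⟩, rfl⟩
      exact hx J k
    · rintro _ ⟨J, ⟨k, rfl⟩, rfl⟩
      exact hy J k
  obtain ⟨x', y', hx', hy', hr'⟩ := exists_dist_ge_of_isCompact hd hd0
    (fun i => convex_convexHull ℝ (x '' {J | ∃ k, J k = i} ∪ y '' {J | ∃ k, J k = i}))
    (fun i => (Set.toFinite _).isCompact_convexHull ℝ) (r := r)
    (fun J => ⟨x J, y J, fun k => subset_convexHull _ _ (.inl ⟨J, ⟨k, rfl⟩, rfl⟩),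
      fun k => subset_convexHull _ _ (.inr ⟨J, ⟨k, rfl⟩, rfl⟩), hr J⟩)
  exact ⟨x', y', fun i => hsub i (hx' i), fun i => hsub i (hy' i), hr'⟩

/-! ### Colorful versions for length and diameter. -/

/-- A colorful Helly theorem for the length of an intersection in a given direction, with
`2 * d` colors in dimension `d`. -/
theorem colorful_helly_inner_sub_eq {E κ α : Type*} [NormedAddCommGroup E]
    [InnerProductSpace ℝ E] [FiniteDimensional ℝ E] [Fintype κ] [Finite α] [Nonempty α]
    (hcard : Fintype.card κ = 2 * Module.finrank ℝ E) {C : κ → α → Set E}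
    (hC : ∀ k a, Convex ℝ (C k a)) {w : E} (hw : w ≠ 0) {r : ℝ}
    (h : ∀ ρ : κ → α, ∃ x y, (∀ k, x ∈ C k (ρ k)) ∧ (∀ k, y ∈ C k (ρ k)) ∧
      inner ℝ w (y - x) = r) :
    ∃ k, ∃ x y, (∀ a, x ∈ C k a) ∧ (∀ a, y ∈ C k a) ∧ inner ℝ w (y - x) = r := by
  have hw2 : ‖w‖ ^ 2 ≠ 0 := pow_ne_zero 2 (norm_ne_zero_iff.2 hw)
  let c : E := (r / ‖w‖ ^ 2) • w
  have hc : inner ℝ w c = r := by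
    simp only [c]
    rw [inner_smul_right, real_inner_self_eq_norm_sq, div_mul_cancel₀ _ hw2]
  -- `(x, v)` encodes the pair `(x, c + x + v)`; `WithLp 2` supplies the inner product that
  -- `colorful_helly` needs.
  let V := WithLp 2 (E × (ℝ ∙ w)ᗮ)
  let s : V →ₗ[ℝ] E :=
    (LinearMap.fst ℝ E (ℝ ∙ w)ᗮ) ∘ₗ (WithLp.linearEquiv 2 ℝ (E × (ℝ ∙ w)ᗮ)).toLinearMap
  let t : V →ₗ[ℝ] E := s + (ℝ ∙ w)ᗮ.subtype ∘ₗ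
    (LinearMap.snd ℝ E (ℝ ∙ w)ᗮ) ∘ₗ (WithLp.linearEquiv 2 ℝ (E × (ℝ ∙ w)ᗮ)).toLinearMap
  have hV : Fintype.card κ = Module.finrank ℝ V + 1 := by
    have h1 := Submodule.finrank_add_finrank_orthogonal (ℝ ∙ w)
    rw [finrank_span_singleton hw] at h1
    have h2 : Module.finrank ℝ V = Module.finrank ℝ E + Module.finrank ℝ (ℝ ∙ w)ᗮ := by
      rw [(WithLp.linearEquiv 2 ℝ (E × (ℝ ∙ w)ᗮ)).finrank_eq, Module.finrank_prod]
    omega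
  have hst : ∀ z, inner ℝ w (c + t z - s z) = r := fun z => by
    have h1 : inner ℝ w (t z - s z) = 0 := by
      simp only [t, LinearMap.add_apply, add_sub_cancel_left]
      exact Submodule.mem_orthogonal_singleton_iff_inner_right.1 (Subtype.prop _)
    rw [add_sub_assoc, inner_add_right, hc, h1, add_zero]
  obtain ⟨k, z, hz⟩ := colorful_helly hV (C := fun k a => s ⁻¹' C k a ∩ t ⁻¹' ((c + ·) ⁻¹' C k a))
    (fun k a => ((hC k a).linear_preimage s).inter
      (((hC k a).translate_preimage_right c).linear_preimage t))
    (fun ρ => by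
      obtain ⟨x, y, hx, hy, hxy⟩ := h ρ
      have horth : y - x - c ∈ (ℝ ∙ w)ᗮ := by
        rw [Submodule.mem_orthogonal_singleton_iff_inner_right, inner_sub_right, hxy, hc, sub_self]
      refine ⟨WithLp.toLp 2 (x, ⟨y - x - c, horth⟩), fun k => ⟨hx k, ?_⟩⟩
      have : c + t (WithLp.toLp 2 (x, ⟨y - x - c, horth⟩)) = y := by
        change c + (x + (y - x - c)) = y
        abel
      simp only [Set.mem_preimage, this]
      exact hy k)
  exact ⟨k, s z, c + t z, fun a => (hz a).1, fun a => (hz a).2, hst z⟩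

/-- A colorful Helly-type theorem for the diameter, with a constant depending on the number of
sets of each color. -/
theorem colorful_exists_dist_ge {E κ α : Type*} [NormedAddCommGroup E]
    [InnerProductSpace ℝ E] [FiniteDimensional ℝ E] [Fintype κ] [Fintype α] [Nonempty α]
    (hcard : Fintype.card κ = 2 * Module.finrank ℝ E) {C : κ → α → Set E}
    (hC : ∀ k a, Convex ℝ (C k a)) {r : ℝ} (hr : 0 < r)
    (h : ∀ ρ : κ → α, ∃ x y, (∀ k, x ∈ C k (ρ k)) ∧ (∀ k, y ∈ C k (ρ k)) ∧ r ≤ dist x y) :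
    ∃ k, ∃ x y, (∀ a, x ∈ C k a) ∧ (∀ a, y ∈ C k a) ∧
      r / (Fintype.card α : ℝ) ^ Fintype.card κ ≤ dist x y := by
  classical
  choose x y hx hy hxy using h
  have hpos : ∀ ρ, 0 < ‖y ρ - x ρ‖ := fun ρ => by
    rw [← dist_eq_norm, dist_comm]
    exact hr.trans_le (hxy ρ)
  obtain ⟨w, hwN, hw⟩ := exists_one_le_abs_inner (fun ρ => ‖y ρ - x ρ‖⁻¹ • (y ρ - x ρ))
    (fun ρ => by rw [norm_smul, norm_inv, norm_norm, inv_mul_cancel₀ (hpos ρ).ne'])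
  rw [Fintype.card_fun, Nat.cast_pow] at hwN
  have hwr : ∀ ρ, r ≤ |inner ℝ w (y ρ - x ρ)| := fun ρ => by
    have h1 := hw ρ
    rw [inner_smul_right, abs_mul, abs_of_pos (inv_pos.2 (hpos ρ)), le_inv_mul_iff₀ (hpos ρ),
      mul_one] at h1
    refine le_trans ?_ h1
    rw [← dist_eq_norm, dist_comm]
    exact hxy ρ
  have hw0 : w ≠ 0 := by
    rintro rfl
    have := hw fun _ => Classical.arbitrary α
    rw [inner_zero_left, abs_zero] at this
    linarith
  obtain ⟨k, x', y', hx', hy', hxy'⟩ := colorful_helly_inner_sub_eq hcard hC hw0 (r := r) (by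
    -- Shortening the segment makes its `w`-length exactly `r`; swapping the endpoints fixes the
    -- sign.
    have key : ∀ (ρ : κ → α) u v, (∀ k, u ∈ C k (ρ k)) → (∀ k, v ∈ C k (ρ k)) → r ≤ inner ℝ w (v - u) →
        ∃ x y, (∀ k, x ∈ C k (ρ k)) ∧ (∀ k, y ∈ C k (ρ k)) ∧ inner ℝ w (y - x) = r := by
      intro ρ u v hu hv huv
      have hp := hr.trans_le huv
      refine ⟨u, u + (r / inner ℝ w (v - u)) • (v - u), hu, fun k =>
        (hC k _).add_smul_sub_mem (hu k) (hv k) ⟨by positivity, (div_le_one hp).2 huv⟩, ?_⟩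
      rw [add_sub_cancel_left, inner_smul_right, div_mul_cancel₀ _ hp.ne']
    intro ρ
    rcases le_abs'.1 (hwr ρ) with h1 | h1
    · refine key ρ (y ρ) (x ρ) (hy ρ) (hx ρ) ?_
      rw [← neg_sub (y ρ), inner_neg_right]
      linarith
    · exact key ρ (x ρ) (y ρ) (hx ρ) (hy ρ) h1)
  refine ⟨k, x', y', hx', hy', ?_⟩
  have hα : (0 : ℝ) < Fintype.card α := by exact_mod_cast Fintype.card_pos
  rw [div_le_iff₀' (by positivity), dist_comm, dist_eq_norm]
  calc r = inner ℝ w (y' - x') := hxy'.symm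
    _ ≤ ‖w‖ * ‖y' - x'‖ := real_inner_le_norm _ _
    _ ≤ _ := mul_le_mul_of_nonneg_right hwN (norm_nonneg _)

/-! ### The main theorem. -/

/-- Colorful Quantitative Diameter Theorem with `2d` colors. The diameter is the extended one
(a supremum in `[0, ∞]`), so that unbounded sets have diameter `∞`. -/
theorem mainTheorem1 (d : ℕ) (hd : 1 ≤ d)
    (F : Fin (2 * d) → Set (Set (EuclideanSpace ℝ (Fin d))))
    (hfin : ∀ i, (F i).Finite)
    (hconv : ∀ i, ∀ K ∈ F i, Convex ℝ K)
    (hdiam : ∀ K : Fin (2 * d) → Set (EuclideanSpace ℝ (Fin d)),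
      (∀ i, K i ∈ F i) → 1 ≤ Metric.ediam (⋂ i, K i)) :
    ∃ i, ENNReal.ofReal (1 / (2 * (d : ℝ) ^ 2 * (2 * (d : ℝ)) ^ (2 * d))) ≤
      Metric.ediam (⋂₀ F i) := by
  by_contra! hcon
  have hd' : (0 : ℝ) < d := by exact_mod_cast hd
  -- An empty family intersects in the whole space, whose diameter is `∞` as `d ≥ 1`.
  have hne : ∀ i, Nonempty (F i) := by
    intro i
    by_contra hemp
    have h1 := hcon i
    rw [Set.not_nonempty_iff_eq_empty'.1 hemp, Set.sInter_empty] at h1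
    have : Nonempty (Fin d) := ⟨⟨0, hd⟩⟩
    have := NormedSpace.noncompactSpace ℝ (EuclideanSpace ℝ (Fin d))
    rw [Metric.ediam_univ_of_noncompact] at h1
    exact not_top_lt h1
  have hfin' : ∀ i, Finite (F i) := hfin
  have hnei : Nonempty (Fin (2 * d)) := ⟨⟨0, by omega⟩⟩
  set c : ℝ := 2 * (d : ℝ) ^ 2 with hc
  set N : ℝ := (2 * (d : ℝ)) ^ (2 * d) with hN
  have hc0 : 0 < c := by positivity
  have hN0 : 0 < N := by positivity
  obtain ⟨i₀, hi₀⟩ := Finite.exists_max fun i => Metric.ediam (⋂₀ F i)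
  obtain ⟨s, hs, hs1⟩ := ENNReal.lt_iff_exists_nnreal_btwn.1 (hcon i₀)
  have hs1' : (s : ℝ) < 1 / (c * N) := by
    rw [← ENNReal.ofReal_coe_nnreal] at hs1
    exact (ENNReal.ofReal_lt_ofReal_iff_of_nonneg s.2).1 hs1
  have hs0 : 0 < (s : ℝ) := by
    exact_mod_cast zero_le.trans_lt hs
  have hdist : ∀ i x y, (∀ K : F i, x ∈ K.1) → (∀ K : F i, y ∈ K.1) → dist x y < s := by
    intro i x y hx hy
    have h1 := Metric.edist_le_ediam_of_mem (Set.mem_sInter.2 fun K hK => hx ⟨K, hK⟩)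
      (Set.mem_sInter.2 fun K hK => hy ⟨K, hK⟩)
    have h2 := (h1.trans (hi₀ i)).trans_lt hs
    rw [edist_nndist] at h2
    exact_mod_cast h2
  have hJ : ∀ i, ∃ J : Fin (2 * d) → F i, ∀ x y, (∀ k, x ∈ (J k).1) → (∀ k, y ∈ (J k).1) →
      dist x y < c * s := by
    intro i
    by_contra! hcon'
    obtain ⟨x, y, hx, hy, hxy⟩ := exists_dist_ge_of_forall_exists_dist_ge finrank_euclideanSpace_fin
      hd (K := fun K : F i => K.1) (fun K => hconv i K.1 K.2) hcon'
    have := hdist i x y hx hy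
    rw [← hc, mul_div_cancel_left₀ _ hc0.ne'] at hxy
    linarith
  choose J hJ using hJ
  obtain ⟨i, x, y, hx, hy, hxy⟩ := colorful_exists_dist_ge (κ := Fin (2 * d)) (α := Fin (2 * d))
    (by simp) (C := fun i k => (J i k).1) (fun i k => hconv i _ (J i k).2) (r := c * s * N)
    (by positivity) (by
      intro ρ
      have h1 : c * s * N < 1 := by
        rw [lt_div_iff₀ (by positivity)] at hs1'
        linarith
      have h2 := hdiam (fun i => (J i (ρ i)).1) fun i => (J i (ρ i)).2
      by_contra! hcon'
      have h3 : Metric.ediam (⋂ i, (J i (ρ i)).1) ≤ ENNReal.ofReal (c * s * N) :=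
        Metric.ediam_le fun x hx y hy => by
          rw [edist_dist]
          exact ENNReal.ofReal_le_ofReal
            (hcon' x y (Set.mem_iInter.1 hx) (Set.mem_iInter.1 hy)).le
      have h4 := h2.trans h3
      rw [← ENNReal.ofReal_one, ENNReal.ofReal_le_ofReal_iff (by positivity)] at h4
      linarith)
  have h1 := hJ i x y hx hy
  simp only [Fintype.card_fin, Nat.cast_mul, Nat.cast_ofNat, ← hN] at hxy
  rw [mul_div_cancel_right₀ _ hN0.ne'] at hxy
  linarith
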